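/- For positive integers $m,n$ and $\theta=(\alpha_1,\dots,\alpha_m,\beta_1,\dots,\beta_{n-1})\in\mathbb{R}^{m+n-1}$, put $\beta_n=0$, $\|\theta\|_\infty=\max_k|\theta_k|$, and let $\mathbb{P}_\theta$ be the law of a random matrix $X=(x_{i,j})\in\{0,1\}^{m\times n}$ whose entries are independent Bernoulli variables with \[\mathbb{P}_\theta(x_{i,j}=1)=\frac{e^{\alpha_i+\beta_j}}{1+e^{\alpha_i+\beta_j}}.\] With $d_i=\sum_{j=1}^n x_{i,j}$ and $b_j=\sum_{i=1}^m x_{i,j}$, the log-likelihood is \[\ell(\theta)=\sum_{i=1}^m\alpha_i d_i+\sum_{j=1}^{n}\beta_j b_j-\sum_{i=1}^m\sum_{j=1}^n\log\bigl(1+e^{\alpha_i+\beta_j}\bigr),\] and a maximum likelihood estimate (MLE) is a maximizer of $\ell$ over $\mathbb{R}^{m+n-1}$. **Theorem.** Let $\tau\in(0,1/24)$ be a constant, let $m=m_n$ be a sequence such that $m$ is of the same order as $n$, i.e. $c\le m/n\le C$ for all large $n$ with constants $0<c\le C<\infty$, and let $\theta^*=\theta^*_n\in\mathbb{R}^{m+n-1}$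 satisfy $\|\theta^*\|_\infty\le\tau\log n$ for all large $n$. Let $X\sim\mathbb{P}_{\theta^*}$. Then, as $n\to\infty$, the probability that an MLE exists tends to one, and, with $\widehat\theta$ denoting the MLE when it exists (and an arbitrary vector otherwise), \[\|\widehat\theta-\theta^*\|_\infty=O_p\!\left(\frac{(\log n)^{1/2}e^{6\|\theta^*\|_\infty}}{n^{1/2}}\right)=o_p(1),\] where the rate in parentheses itself tends to $0$. Moreover, for all $m,n\ge1$ and every observed matrix in $\{0,1\}^{m\times n}$, if an MLE exists, it is unique. -/

import Mathlib

open MeasureTheory ProbabilityTheory Filter Topology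

noncomputable section

namespace Affiliation

/-- The `m × n` affiliation matrices with entries in `{0, 1}` (`true` stands for `1`). -/
abbrev Graph (m n : ℕ) : Type := Fin m × Fin n → Bool

/-- The parameter vectors `θ = (α₁, …, α_m, β₁, …, β_{n-1})` in `ℝ^{m+n-1}`.
The norm of this function space is the maximum norm `‖θ‖_∞`. -/
abbrev Param (m n : ℕ) : Type := Fin m ⊕ Fin (n - 1) → ℝ

variable {m n : ℕ}

/-- The coordinate `α_i`. -/
def alpha (θ : Param m n) (i : Fin m) : ℝ := θ (Sum.inl i)

/-- The coordinate `β_j`; the last one, `β_n`, is zero by convention. -/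
def beta (θ : Param m n) (j : Fin n) : ℝ :=
  if h : j.1 < n - 1 then θ (Sum.inr ⟨j.1, h⟩) else 0

/-- The entry `x_{i,j}` as a real number. -/
def entry (x : Graph m n) (i : Fin m) (j : Fin n) : ℝ := if x (i, j) then 1 else 0

/-- The row sum `d_i`. -/
def rowDegree (x : Graph m n) (i : Fin m) : ℝ := ∑ j, entry x i j

/-- The column sum `b_j`. -/
def colDegree (x : Graph m n) (j : Fin n) : ℝ := ∑ i, entry x i j

/-- The log-likelihood `∑ α_i d_i + ∑ β_j b_j - ∑ log (1 + exp (α_i + β_j))`. -/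
def logLikelihood (x : Graph m n) (θ : Param m n) : ℝ :=
  ∑ i, alpha θ i * rowDegree x i + ∑ j, beta θ j * colDegree x j
    - ∑ i, ∑ j, Real.log (1 + Real.exp (alpha θ i + beta θ j))

/-- `θ` is a maximum likelihood estimate from the observation `x`. -/
def IsMLE (x : Graph m n) (θ : Param m n) : Prop :=
  ∀ θ' : Param m n, logLikelihood x θ' ≤ logLikelihood x θ

/-- The law of the affiliation matrix under `θ`: the entries are independent, and `x_{i,j}` is
Bernoulli with success probability `exp (α_i + β_j) / (1 + exp (α_i + β_j))`. -/
def law (θ : Param m n) : Measure (Graph m n) :=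
  Measure.pi fun p : Fin m × Fin n =>
    bernoulliMeasure true false (unitInterval.sigmoid (alpha θ p.1 + beta θ p.2))

instance (θ : Param m n) : IsProbabilityMeasure (law θ) := by
  unfold law; infer_instance

/-- The law in exponential form: the likelihood is the probability of the observation. -/
theorem law_singleton (θ : Param m n) (x : Graph m n) :
    law θ {x} = ENNReal.ofReal (Real.exp (logLikelihood x θ)) := by
  have key : ∀ (t : ℝ) (b : Bool),
      bernoulliMeasure true false (unitInterval.sigmoid t) {b}
        = ENNReal.ofReal (Real.exp (t * (if b then 1 else 0) - Real.log (1 + Real.exp t))) := by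
    intro t b
    have hpos : 0 < 1 + Real.exp t := by positivity
    have hsig : Real.sigmoid t = Real.exp t / (1 + Real.exp t) := by
      rw [Real.sigmoid_def, Real.exp_neg]
      field_simp
      ring
    have hcoe : ∀ p : unitInterval,
        ((unitInterval.toNNReal p : NNReal) : ENNReal) = ENNReal.ofReal (p : ℝ) := fun p =>
      (ENNReal.ofReal_eq_coe_nnreal p.2.1).symm
    have hval : ((unitInterval.sigmoid t : unitInterval) : ℝ) = Real.sigmoid t := rfl
    rw [Real.exp_sub, Real.exp_log hpos]
    cases b
    · simp only [bernoulliMeasure_def]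
      simp [hcoe, hval, hsig]
      congr 1
      field_simp
      ring
    · simp [bernoulliMeasure_def, hcoe, hval, hsig]
  have hsum : logLikelihood x θ = ∑ p : Fin m × Fin n,
      ((alpha θ p.1 + beta θ p.2) * (if x p then 1 else 0)
        - Real.log (1 + Real.exp (alpha θ p.1 + beta θ p.2))) := by
    rw [Fintype.sum_prod_type]
    simp only [logLikelihood, rowDegree, colDegree, entry, Finset.sum_sub_distrib, add_mul,
      Finset.sum_add_distrib, Finset.mul_sum]
    rw [Finset.sum_comm (f := fun (j : Fin n) (i : Fin m) => beta θ j * _)]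
  rw [law, Measure.pi_singleton, hsum, Real.exp_sum,
    ENNReal.ofReal_prod_of_nonneg fun _ _ => (Real.exp_pos _).le]
  exact Finset.prod_congr rfl fun p _ => key _ _

end Affiliation

/-- `Y_n = O_p(a_n)`, where `Y_n` is a real random variable on the probability space
`(Ω n, P n)` and `a_n` is a deterministic nonnegative sequence. -/
def IsBigOInProbability {Ω : ℕ → Type*} [∀ n, MeasurableSpace (Ω n)] (P : ∀ n, Measure (Ω n))
    (Y : ∀ n, Ω n → ℝ) (a : ℕ → ℝ) : Prop :=
  ∀ ε : ℝ, 0 < ε → ∃ M : ℝ, 0 < M ∧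
    ∀ᶠ n in atTop, P n {ω | M * a n < |Y n ω|} ≤ ENNReal.ofReal ε

/-- `Y_n = o_p(a_n)`. -/
def IsLittleOInProbability {Ω : ℕ → Type*} [∀ n, MeasurableSpace (Ω n)] (P : ∀ n, Measure (Ω n))
    (Y : ∀ n, Ω n → ℝ) (a : ℕ → ℝ) : Prop :=
  ∀ δ : ℝ, 0 < δ → Tendsto (fun n => P n {ω | δ * a n < |Y n ω|}) atTop (𝓝 0)

end

/-! ### The logistic link -/

/-! Drop the constraint `β_n = 0` and maximize the likelihood over the compact box of sup-norm
radius `R` around the true effects `(α, β)`. Let `u`, `v` be the deviations of a maximizer and `h i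
j` the resulting change in the success probabilities. Since the logistic slope on the relevant range
lies between `q = exp (-B) / 4` and `1`, `h i j` has the sign of `u i + v j` and is comparable to
it. First-order conditions bound the row and column sums of `h` by the noise level `D`, except where
a face of the box blocks the move.

The heart is `IsBoxCritical.not_touch`. If some `u i = R`, the flows of row `i` are all nonnegative
with total at most `D`, so the `v j` are close to `-R` on average. When `2 * D < k * q ^ 2 * R`,
this rules out another `u` at `-R` (`not_top_bot`) and any `v` at `R` (`not_top_top`). The faces
still possible can be left together by a small shift `(a + c, b - c)`, which preserves the
likelihood. The maximizer then sits in the open box, and concavity makes it global. Restoring `β_n =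
0` costs a factor 2 in the distance.

Hoeffding's inequality gives `D` of order `sqrt (n log n)` with high probability. With `k` of order
`n` and `q ^ 2` of order `exp (-4‖θ‖)`, an `R` of the claimed order suffices. Strict concavity gives
uniqueness, which identifies any chosen MLE with the one found near the truth. -/

theorem hasDerivAt_log_one_add_exp (t : ℝ) :
    HasDerivAt (fun t => Real.log (1 + Real.exp t)) (Real.sigmoid t) t := by
  have h := ((Real.hasDerivAt_exp t).const_add 1).log (by positivity)
  convert h using 1
  rw [Real.sigmoid_def, Real.exp_neg]
  field_simp
  ring

theorem strictConvexOn_log_one_add_exp :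
    StrictConvexOn ℝ Set.univ (fun t => Real.log (1 + Real.exp t)) := by
  refine StrictMonoOn.strictConvexOn_of_deriv convex_univ
    (fun t _ => (hasDerivAt_log_one_add_exp t).continuousAt.continuousWithinAt) ?_
  have : deriv (fun t => Real.log (1 + Real.exp t)) = Real.sigmoid :=
    funext fun t => (hasDerivAt_log_one_add_exp t).deriv
  rw [this]
  exact Real.sigmoid_strictMono.strictMonoOn _

/-- The derivative is even, and for `s ≥ 0` it equals `σ(s)² exp (-s)` with `σ(s) ≥ 1/2`. -/
theorem exp_neg_div_four_le_deriv_sigmoid {B t : ℝ} (ht : |t| ≤ B) :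
    Real.exp (-B) / 4 ≤ deriv Real.sigmoid t := by
  have key : ∀ s : ℝ, |s| ≤ B → 0 ≤ s →
      Real.exp (-B) / 4 ≤ Real.sigmoid s * (1 - Real.sigmoid s) := by
    intro s hs h0
    have h1 : Real.exp (-B) ≤ Real.exp (-s) := Real.exp_le_exp.2 (by linarith [le_abs_self s])
    have h2 : Real.exp (-s) ≤ 1 := Real.exp_le_one_iff.2 (by linarith)
    have h3 : (1 / 2 : ℝ) ≤ Real.sigmoid s := by
      have := Real.sigmoid_le h0
      rw [Real.sigmoid_zero] at this
      linarith
    rw [← Real.sigmoid_neg, ← Real.sigmoid_mul_rexp_neg]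
    have := Real.exp_pos (-s)
    nlinarith [mul_le_mul h3 h3 (by norm_num) (by linarith)]
  rw [Real.deriv_sigmoid]
  rcases le_total 0 t with h | h
  · exact key t ht h
  · have := key (-t) (by rwa [abs_neg]) (by linarith)
    rw [Real.sigmoid_neg] at this
    linarith

theorem deriv_sigmoid_le_one (t : ℝ) : deriv Real.sigmoid t ≤ 1 := by
  rw [Real.deriv_sigmoid]
  nlinarith [Real.sigmoid_pos t, Real.sigmoid_lt_one t]

theorem sigmoid_sub_mem_Icc {B s t : ℝ} (hs : |s| ≤ B) (ht : |t| ≤ B) (hst : s ≤ t) :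
    Real.sigmoid t - Real.sigmoid s ∈ Set.Icc (Real.exp (-B) / 4 * (t - s)) (t - s) := by
  rw [abs_le] at hs ht
  have hd : DifferentiableOn ℝ Real.sigmoid (interior (Set.Icc (-B) B)) :=
    differentiable_sigmoid.differentiableOn
  have hc : ContinuousOn Real.sigmoid (Set.Icc (-B) B) := continuous_sigmoid.continuousOn
  constructor
  · refine (convex_Icc (-B) B).mul_sub_le_image_sub_of_le_deriv hc hd ?_ s hs t ht hst
    intro x hx
    have hx' : x ∈ Set.Icc (-B) B := interior_subset hx
    exact exp_neg_div_four_le_deriv_sigmoid (abs_le.2 hx')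
  · simpa using (convex_Icc (-B) B).image_sub_le_mul_sub_of_deriv_le hc hd
      (C := 1) (fun x _ => deriv_sigmoid_le_one x) s hs t ht hst

/-! ### Potentials confined to a box -/

section Box

variable {ι κ : Type*} [Fintype ι] [Fintype κ]

/-- Potentials `u`, `v` in the box of radius `R` with flows `h i j`, comparable to `u i + v j`,
whose divergence is at most `D` at the vertices where it is not compensated by a face of the box. -/
structure IsBoxCritical (q D R : ℝ) (u : ι → ℝ) (v : κ → ℝ) (h : ι → κ → ℝ) : Prop where
  abs_left_le : ∀ i, |u i| ≤ R
  abs_right_le : ∀ j, |v j| ≤ R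
  of_nonneg : ∀ i j, 0 ≤ u i + v j → q * (u i + v j) ≤ h i j ∧ h i j ≤ u i + v j
  of_nonpos : ∀ i j, u i + v j ≤ 0 → u i + v j ≤ h i j ∧ h i j ≤ q * (u i + v j)
  row_le : ∀ i, -R < u i → ∑ j, h i j ≤ D
  le_row : ∀ i, u i < R → -D ≤ ∑ j, h i j
  col_le : ∀ j, -R < v j → ∑ i, h i j ≤ D
  le_col : ∀ j, v j < R → -D ≤ ∑ i, h i j

namespace IsBoxCritical

variable {q D R k : ℝ} {u : ι → ℝ} {v : κ → ℝ} {h : ι → κ → ℝ}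

theorem swap (H : IsBoxCritical q D R u v h) : IsBoxCritical q D R v u (fun j i => h i j) where
  abs_left_le := H.abs_right_le
  abs_right_le := H.abs_left_le
  of_nonneg j i hs := by rw [add_comm] at hs ⊢; exact H.of_nonneg i j hs
  of_nonpos j i hs := by rw [add_comm] at hs ⊢; exact H.of_nonpos i j hs
  row_le := H.col_le
  le_row := H.le_col
  col_le := H.row_le
  le_col := H.le_row

theorem neg (H : IsBoxCritical q D R u v h) :
    IsBoxCritical q D R (fun i => -u i) (fun j => -v j) (fun i j => -h i j) where
  abs_left_le i := by simpa using H.abs_left_le i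
  abs_right_le j := by simpa using H.abs_right_le j
  of_nonneg i j hs := by
    have := H.of_nonpos i j (by linarith)
    constructor <;> linarith [this.1, this.2]
  of_nonpos i j hs := by
    have := H.of_nonneg i j (by linarith)
    constructor <;> linarith [this.1, this.2]
  row_le i hi := by
    have := H.le_row i (by linarith)
    rw [Finset.sum_neg_distrib]; linarith
  le_row i hi := by
    have := H.row_le i (by linarith)
    rw [Finset.sum_neg_distrib]; linarith
  col_le j hj := by
    have := H.le_col j (by linarith)
    rw [Finset.sum_neg_distrib]; linarith
  le_col j hj := by
    have := H.col_le j (by linarith)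
    rw [Finset.sum_neg_distrib]; linarith

/-- At the top face every `u i + v j = R + v j` is nonnegative, so no cancellation occurs in the row
sum: the `v j` must be near `-R` on average. -/
theorem sum_le_of_eq_top (H : IsBoxCritical q D R u v h) (hR : 0 < R) {i : ι} (hi : u i = R) :
    q * ∑ j, (R + v j) ≤ D := by
  refine le_trans ?_ (H.row_le i (by linarith))
  rw [Finset.mul_sum]
  refine Finset.sum_le_sum fun j _ => ?_
  have h1 := H.of_nonneg i j (by linarith [(abs_le.1 (H.abs_right_le j)).1])
  rw [← hi]
  exact h1.1

theorem sum_le_of_eq_bot (H : IsBoxCritical q D R u v h) (hR : 0 < R) {i : ι} (hi : u i = -R) :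
    q * ∑ j, (R - v j) ≤ D := by
  simpa [sub_eq_add_neg] using H.neg.sum_le_of_eq_top hR (i := i) (by linarith)

/-- The `v j` would have to be near `-R` and near `R` on average; the two sums add up to `2R` per
column. -/
theorem not_top_bot (H : IsBoxCritical q D R u v h) (hR : 0 < R) (hq : 0 < q) (hq1 : q ≤ 1)
    (hk : k ≤ Fintype.card κ) (hD : 2 * D < k * q ^ 2 * R)
    {i i' : ι} (hi : u i = R) (hi' : u i' = -R) : False := by
  have h1 := H.sum_le_of_eq_top hR hi
  have h2 := H.sum_le_of_eq_bot hR hi'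
  have h3 : ∑ j, (R + v j) + ∑ j, (R - v j) = Fintype.card κ * (2 * R) := by
    rw [← Finset.sum_add_distrib]
    simp [← two_mul]
  have h4 : q * (Fintype.card κ * (2 * R)) ≤ 2 * D := by rw [← h3]; linarith
  have h5 : k * q ^ 2 * R ≤ Fintype.card κ * q ^ 2 * R := by gcongr
  have h6 : (Fintype.card κ : ℝ) * q ^ 2 * R ≤ Fintype.card κ * q * R := by
    gcongr
    nlinarith
  have h7 : 0 ≤ (Fintype.card κ : ℝ) * q * R := by positivity
  linarith

/-- Most of `u` and `v` would be near `-R`, so a column with a very low `v l` would carry a strongly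
negative total flow, although its divergence is at least `-D`. -/
theorem not_top_top (H : IsBoxCritical q D R u v h) (hR : 0 < R) (hq : 0 < q) (hq1 : q ≤ 1)
    (hk0 : 0 < k) (hk : k ≤ Fintype.card ι) (hk' : k ≤ Fintype.card κ)
    (hD : 2 * D < k * q ^ 2 * R) {i : ι} {j : κ} (hi : u i = R) (hj : v j = R) : False := by
  have h1 := H.sum_le_of_eq_top hR hi
  have h2 := H.swap.sum_le_of_eq_top hR hj
  have hκ : (0 : ℝ) < Fintype.card κ := hk0.trans_le hk'
  have hι : (0 : ℝ) < Fintype.card ι := hk0.trans_le hk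
  have hD0 : 0 ≤ D := le_trans (mul_nonneg hq.le (Finset.sum_nonneg fun j _ => by
    linarith [(abs_le.1 (H.abs_right_le j)).1])) h1
  -- Pigeonhole: some `v l` is no larger than the average allows.
  obtain ⟨l, hl⟩ : ∃ l, k * q * (R + v l) ≤ D := by
    by_contra! hcon
    have h3 : ∑ _l : κ, D < ∑ l, k * q * (R + v l) :=
      Finset.sum_lt_sum_of_nonempty ⟨j, Finset.mem_univ _⟩ fun l _ => hcon l
    rw [← Finset.mul_sum, Finset.sum_const, Finset.card_univ, nsmul_eq_mul] at h3
    have h4 : k * D ≤ Fintype.card κ * D := by gcongr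
    nlinarith
  have hkq : k * q ^ 2 * R ≤ k * q * R := by
    gcongr
    nlinarith
  have hkqR : 0 < k * q * R := by positivity
  have hlR : v l < R := by
    by_contra! hcon
    nlinarith [mul_le_mul_of_nonneg_left hcon (by positivity : 0 ≤ k * q)]
  have h5 := H.le_col l hlR
  -- Split `u i + v l` as `(R + u i) + (v l - R)`, nonnegative plus nonpositive, with slope at most
  -- `1` on the first and at least `q` on the second.
  have h6 : ∑ i, h i l ≤ ∑ i, ((R + u i) + q * (v l - R)) := by
    refine Finset.sum_le_sum fun i _ => ?_
    have hu := (abs_le.1 (H.abs_left_le i)).1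
    rcases le_total 0 (u i + v l) with hs | hs
    · have := (H.of_nonneg i l hs).2
      nlinarith
    · have := (H.of_nonpos i l hs).2
      nlinarith
  rw [Finset.sum_add_distrib, Finset.sum_const, Finset.card_univ, nsmul_eq_mul] at h6
  have h7 : (Fintype.card ι : ℝ) * (q * (v l - R)) ≤ k * (q * (v l - R)) :=
    mul_le_mul_of_nonpos_right hk (by nlinarith)
  have h8 : q * (-D) ≤ D + q * (k * (q * (v l - R))) := by nlinarith
  -- With `h8` this yields `2 k q² R ≤ D + 2 q D ≤ 3 D`, against `4 D < 2 k q² R`.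
  have h9 : q * (k * q * (R + v l)) ≤ q * D := by gcongr
  nlinarith

/-- A potential cannot touch opposite faces of a large box. -/
theorem not_touch (H : IsBoxCritical q D R u v h) (hR : 0 < R) (hq : 0 < q) (hq1 : q ≤ 1)
    (hk0 : 0 < k) (hk : k ≤ Fintype.card ι) (hk' : k ≤ Fintype.card κ)
    (hD : 2 * D < k * q ^ 2 * R) :
    (∀ i, u i < R) ∧ (∀ j, -R < v j) ∨ (∀ i, -R < u i) ∧ (∀ j, v j < R) := by
  by_contra hcon
  have hu := fun i => abs_le.1 (H.abs_left_le i)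
  have hv := fun j => abs_le.1 (H.abs_right_le j)
  have h1 : (∃ i, u i = R) ∨ ∃ j, v j = -R := by
    by_contra! h
    exact hcon (Or.inl ⟨fun i => lt_of_le_of_ne (hu i).2 (h.1 i),
      fun j => lt_of_le_of_ne (hv j).1 (h.2 j).symm⟩)
  have h2 : (∃ i, u i = -R) ∨ ∃ j, v j = R := by
    by_contra! h
    exact hcon (Or.inr ⟨fun i => lt_of_le_of_ne (hu i).1 (h.1 i).symm,
      fun j => lt_of_le_of_ne (hv j).2 (h.2 j)⟩)
  rcases h1 with ⟨i, hi⟩ | ⟨j, hj⟩ <;> rcases h2 with ⟨i', hi'⟩ | ⟨j', hj'⟩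
  · exact H.not_top_bot hR hq hq1 hk' hD hi hi'
  · exact H.not_top_top hR hq hq1 hk0 hk hk' hD hi hj'
  · exact H.neg.not_top_top hR hq hq1 hk0 hk hk' hD (i := i') (j := j) (by linarith) (by linarith)
  · exact H.swap.not_top_bot (i := j') (i' := j) hR hq hq1 hk hD (by assumption) (by assumption)

end IsBoxCritical

/-! ### The logistic likelihood with row and column effects -/

noncomputable section

/-- The log-likelihood of the logistic model with row effects `a` and column effects `b`. -/
def logisticLik (y : ι → κ → ℝ) (a : ι → ℝ) (b : κ → ℝ) : ℝ :=
  ∑ i, ∑ j, ((a i + b j) * y i j - Real.log (1 + Real.exp (a i + b j)))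

theorem logisticLik_swap (y : ι → κ → ℝ) (a : ι → ℝ) (b : κ → ℝ) :
    logisticLik (fun j i => y i j) b a = logisticLik y a b := by
  unfold logisticLik
  rw [Finset.sum_comm]
  simp only [add_comm]

/-- The gauge freedom, used both to leave the faces of the box and to restore `β_n = 0`. -/
theorem logisticLik_shift (y : ι → κ → ℝ) (a : ι → ℝ) (b : κ → ℝ) (c : ℝ) :
    logisticLik y (fun i => a i + c) (fun j => b j - c) = logisticLik y a b := by
  unfold logisticLik
  simp only [add_add_sub_cancel]

theorem concaveOn_logistic_term (y : ℝ) :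
    ConcaveOn ℝ Set.univ (fun t : ℝ => t * y - Real.log (1 + Real.exp t)) := by
  refine ConcaveOn.sub ?_ strictConvexOn_log_one_add_exp.convexOn
  exact (LinearMap.concaveOn (LinearMap.mulRight ℝ y) convex_univ)

theorem concaveOn_logisticLik (y : ι → κ → ℝ) :
    ConcaveOn ℝ Set.univ (fun p : (ι → ℝ) × (κ → ℝ) => logisticLik y p.1 p.2) := by
  refine ⟨convex_univ, fun p _ p' _ s t hs ht hst => ?_⟩
  simp only [logisticLik, Finset.smul_sum, ← Finset.sum_add_distrib]
  refine Finset.sum_le_sum fun i _ => Finset.sum_le_sum fun j _ => ?_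
  have := (concaveOn_logistic_term (y i j)).2 (Set.mem_univ (p.1 i + p.2 j))
    (Set.mem_univ (p'.1 i + p'.2 j)) hs ht hst
  refine this.trans_eq ?_
  have e : s • (p.1 i + p.2 j) + t • (p'.1 i + p'.2 j)
      = (s • p + t • p').1 i + (s • p + t • p').2 j := by
    simp; ring
  rw [e]

theorem continuous_logisticLik (y : ι → κ → ℝ) :
    Continuous (fun p : (ι → ℝ) × (κ → ℝ) => logisticLik y p.1 p.2) := by
  unfold logisticLik
  refine continuous_finsetSum _ fun i _ => continuous_finsetSum _ fun j _ => ?_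
  refine Continuous.sub (by fun_prop) (Continuous.log (by fun_prop) fun p => ?_)
  positivity

/-! ### First-order conditions on a box -/

theorem hasDerivAt_logisticLik_left (y : ι → κ → ℝ) (a e : ι → ℝ) (b : κ → ℝ) :
    HasDerivAt (fun t : ℝ => logisticLik y (fun i => a i + t * e i) b)
      (∑ i, e i * ∑ j, (y i j - Real.sigmoid (a i + b j))) 0 := by
  unfold logisticLik
  refine HasDerivAt.fun_sum fun i _ => ?_
  rw [Finset.mul_sum]
  refine HasDerivAt.fun_sum fun j _ => ?_
  have h1 : HasDerivAt (fun t : ℝ => a i + t * e i + b j) (e i) 0 := by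
    simpa using (((hasDerivAt_id (0 : ℝ)).mul_const (e i)).const_add (a i)).add_const (b j)
  have h2 : HasDerivAt (fun t : ℝ => Real.log (1 + Real.exp (a i + t * e i + b j)))
      (Real.sigmoid (a i + b j) * e i) 0 := by
    refine HasDerivAt.comp (0 : ℝ) (h₂ := fun t => Real.log (1 + Real.exp t)) ?_ h1
    simpa using hasDerivAt_log_one_add_exp (a i + b j)
  exact ((h1.mul_const (y i j)).fun_sub h2).congr_deriv (by ring)

theorem deriv_nonpos_of_eventually_le {g : ℝ → ℝ} {d : ℝ} (hg : HasDerivAt g d 0)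
    (h : ∀ᶠ t in 𝓝[>] (0 : ℝ), g t ≤ g 0) : d ≤ 0 := by
  refine le_of_tendsto hg.tendsto_slope_zero_right ?_
  filter_upwards [h, self_mem_nhdsWithin] with t ht ht0
  simp only [zero_add, smul_eq_mul]
  exact mul_nonpos_of_nonneg_of_nonpos (inv_nonneg.2 (le_of_lt ht0)) (by linarith)

/-- First-order condition at a maximizer over a box, for a move of one row effect
in the direction `δ`. -/
theorem mul_sum_nonpos_of_box_max {y : ι → κ → ℝ} {a α : ι → ℝ} {b : κ → ℝ} {R δ : ℝ}
    (ha : ∀ i, |a i - α i| ≤ R)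
    (hmax : ∀ a' : ι → ℝ, (∀ i, |a' i - α i| ≤ R) → logisticLik y a' b ≤ logisticLik y a b)
    (i : ι) (hi : ∀ᶠ t in 𝓝[>] (0 : ℝ), |a i + t * δ - α i| ≤ R) :
    δ * ∑ j, (y i j - Real.sigmoid (a i + b j)) ≤ 0 := by
  classical
  have hd := hasDerivAt_logisticLik_left y a (Pi.single i δ) b
  have hsum : ∑ l, (Pi.single i δ : ι → ℝ) l * ∑ j, (y l j - Real.sigmoid (a l + b j))
      = δ * ∑ j, (y i j - Real.sigmoid (a i + b j)) := by
    rw [Finset.sum_eq_single i]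
    · simp
    · intro l _ hl
      simp [hl]
    · simp
  rw [hsum] at hd
  refine deriv_nonpos_of_eventually_le hd ?_
  filter_upwards [hi] with t ht
  simp only [zero_mul, add_zero]
  refine hmax _ fun l => ?_
  by_cases hl : l = i
  · subst hl
    simpa using ht
  · simpa [hl] using ha l

theorem eventually_add_mul_lt {x δ r : ℝ} (hx : x < r) :
    ∀ᶠ t in 𝓝[>] (0 : ℝ), x + t * δ < r := by
  have : Tendsto (fun t : ℝ => x + t * δ) (𝓝[>] 0) (𝓝 (x + 0 * δ)) :=
    ((by fun_prop : Continuous fun t : ℝ => x + t * δ).tendsto 0).mono_left nhdsWithin_le_nhds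
  exact this.eventually_lt_const (by simpa using hx)

theorem row_conditions_of_box_max {y : ι → κ → ℝ} {a α : ι → ℝ} {b : κ → ℝ} {R : ℝ}
    (ha : ∀ i, |a i - α i| ≤ R)
    (hmax : ∀ a' : ι → ℝ, (∀ i, |a' i - α i| ≤ R) → logisticLik y a' b ≤ logisticLik y a b)
    (i : ι) :
    (-R < a i - α i → 0 ≤ ∑ j, (y i j - Real.sigmoid (a i + b j))) ∧
      (a i - α i < R → ∑ j, (y i j - Real.sigmoid (a i + b j)) ≤ 0) := by
  have h := abs_le.1 (ha i)
  constructor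
  · intro hi
    have := mul_sum_nonpos_of_box_max (δ := -1) ha hmax i (by
      filter_upwards [eventually_add_mul_lt (x := α i - a i) (δ := 1) (r := R) (by linarith),
        self_mem_nhdsWithin] with t ht (ht0 : 0 < t)
      rw [abs_le]
      constructor <;> linarith)
    linarith
  · intro hi
    have := mul_sum_nonpos_of_box_max (δ := 1) ha hmax i (by
      filter_upwards [eventually_add_mul_lt (x := a i - α i) (δ := 1) (r := R) (by linarith),
        self_mem_nhdsWithin] with t ht (ht0 : 0 < t)
      rw [abs_le]
      constructor <;> linarith)
    linarith

/-- Each row or column sum of the flow is the residual at the truth minus the score at the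
maximizer; the first is at most `D` in size, the second has a known sign off the faces. The `2 * R`
keeps both arguments of the sigmoid in `[-B, B]`. -/
theorem isBoxCritical_of_box_max {y : ι → κ → ℝ} {a α : ι → ℝ} {b β : κ → ℝ} {R D B : ℝ}
    (hR : 0 < R) (hB : ∀ i j, |α i + β j| + 2 * R ≤ B)
    (ha : ∀ i, |a i - α i| ≤ R) (hb : ∀ j, |b j - β j| ≤ R)
    (hmax : ∀ (a' : ι → ℝ) (b' : κ → ℝ), (∀ i, |a' i - α i| ≤ R) → (∀ j, |b' j - β j| ≤ R) →
      logisticLik y a' b' ≤ logisticLik y a b)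
    (hrow : ∀ i, |∑ j, (y i j - Real.sigmoid (α i + β j))| ≤ D)
    (hcol : ∀ j, |∑ i, (y i j - Real.sigmoid (α i + β j))| ≤ D) :
    IsBoxCritical (Real.exp (-B) / 4) D R (fun i => a i - α i) (fun j => b j - β j)
      (fun i j => Real.sigmoid (a i + b j) - Real.sigmoid (α i + β j)) := by
  have hB1 : ∀ i j, |α i + β j| ≤ B := fun i j => by linarith [hB i j]
  have hB2 : ∀ i j, |a i + b j| ≤ B := fun i j => by
    have h1 := abs_le.1 (ha i)
    have h2 := abs_le.1 (hb j)
    refine le_trans ?_ (hB i j)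
    rw [abs_le]
    constructor <;> linarith [le_abs_self (α i + β j), neg_abs_le (α i + β j)]
  have hr := row_conditions_of_box_max ha (fun a' h => hmax a' b h hb)
  have hc := row_conditions_of_box_max (y := fun j i => y i j) (a := b) (α := β) (b := a) hb
    (fun b' h => by simpa only [logisticLik_swap] using hmax a b' ha h)
  simp only [add_comm (b _) (a _)] at hc
  have er : ∀ i, ∑ j, (Real.sigmoid (a i + b j) - Real.sigmoid (α i + β j))
      = ∑ j, (y i j - Real.sigmoid (α i + β j)) - ∑ j, (y i j - Real.sigmoid (a i + b j)) := by
    intro i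
    rw [← Finset.sum_sub_distrib]
    exact Finset.sum_congr rfl fun j _ => by ring
  have ec : ∀ j, ∑ i, (Real.sigmoid (a i + b j) - Real.sigmoid (α i + β j))
      = ∑ i, (y i j - Real.sigmoid (α i + β j)) - ∑ i, (y i j - Real.sigmoid (a i + b j)) := by
    intro j
    rw [← Finset.sum_sub_distrib]
    exact Finset.sum_congr rfl fun i _ => by ring
  have ediff : ∀ i j, a i - α i + (b j - β j) = (a i + b j) - (α i + β j) := fun i j => by ring
  refine ⟨ha, hb, fun i j hs => ?_, fun i j hs => ?_, fun i hi => ?_, fun i hi => ?_,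
    fun j hj => ?_, fun j hj => ?_⟩
  · rw [ediff] at hs ⊢
    exact sigmoid_sub_mem_Icc (hB1 i j) (hB2 i j) (by linarith)
  · rw [ediff] at hs ⊢
    have := sigmoid_sub_mem_Icc (hB2 i j) (hB1 i j) (by linarith)
    constructor <;> linarith [this.1, this.2]
  · rw [er]
    linarith [(hr i).1 hi, (abs_le.1 (hrow i)).2]
  · rw [er]
    linarith [(hr i).2 hi, (abs_le.1 (hrow i)).1]
  · rw [ec]
    linarith [(hc j).1 hj, (abs_le.1 (hcol j)).2]
  · rw [ec]
    linarith [(hc j).2 hj, (abs_le.1 (hcol j)).1]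

/-- A maximizer over a box that lies in the open box is a global maximizer. -/
theorem logisticLik_le_of_open_box {y : ι → κ → ℝ} {a α : ι → ℝ} {b β : κ → ℝ} {R : ℝ}
    (ha : ∀ i, |a i - α i| < R) (hb : ∀ j, |b j - β j| < R)
    (hmax : ∀ (a' : ι → ℝ) (b' : κ → ℝ), (∀ i, |a' i - α i| ≤ R) → (∀ j, |b' j - β j| ≤ R) →
      logisticLik y a' b' ≤ logisticLik y a b) (a' : ι → ℝ) (b' : κ → ℝ) :
    logisticLik y a' b' ≤ logisticLik y a b := by
  have hloc : IsLocalMaxOn (fun p : (ι → ℝ) × (κ → ℝ) => logisticLik y p.1 p.2)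
      Set.univ (a, b) := by
    rw [isLocalMaxOn_univ_iff]
    have h1 : ∀ᶠ p : (ι → ℝ) × (κ → ℝ) in 𝓝 (a, b), ∀ i, |p.1 i - α i| < R :=
      eventually_all.2 fun i =>
        ((by fun_prop : Continuous fun p : (ι → ℝ) × (κ → ℝ) => |p.1 i - α i|).tendsto
          (a, b)).eventually_lt_const (ha i)
    have h2 : ∀ᶠ p : (ι → ℝ) × (κ → ℝ) in 𝓝 (a, b), ∀ j, |p.2 j - β j| < R :=
      eventually_all.2 fun j =>
        ((by fun_prop : Continuous fun p : (ι → ℝ) × (κ → ℝ) => |p.2 j - β j|).tendsto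
          (a, b)).eventually_lt_const (hb j)
    filter_upwards [h1, h2] with p hp1 hp2
    exact hmax p.1 p.2 (fun i => (hp1 i).le) (fun j => (hp2 j).le)
  have hglob := IsMaxOn.of_isLocalMaxOn_of_concaveOn (Set.mem_univ _) hloc (concaveOn_logisticLik y)
  exact hglob (Set.mem_univ (_, _))

/-- If the row and column residuals at `(α, β)` are small, the likelihood has a global maximizer
near `(α, β)`. -/
theorem exists_logisticLik_max_near {y : ι → κ → ℝ} {α : ι → ℝ} {β : κ → ℝ} {R D B k : ℝ}
    (hR : 0 < R) (hB : ∀ i j, |α i + β j| + 2 * R ≤ B)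
    (hk0 : 0 < k) (hk : k ≤ Fintype.card ι) (hk' : k ≤ Fintype.card κ)
    (hD : 2 * D < k * (Real.exp (-B) / 4) ^ 2 * R)
    (hrow : ∀ i, |∑ j, (y i j - Real.sigmoid (α i + β j))| ≤ D)
    (hcol : ∀ j, |∑ i, (y i j - Real.sigmoid (α i + β j))| ≤ D) :
    ∃ (a : ι → ℝ) (b : κ → ℝ), (∀ i, |a i - α i| ≤ R) ∧ (∀ j, |b j - β j| ≤ R) ∧
      ∀ (a' : ι → ℝ) (b' : κ → ℝ), logisticLik y a' b' ≤ logisticLik y a b := by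
  have mem : ∀ (a : ι → ℝ) (b : κ → ℝ),
      (a, b) ∈ (Set.univ.pi fun i => Set.Icc (α i - R) (α i + R)) ×ˢ
        (Set.univ.pi fun j => Set.Icc (β j - R) (β j + R)) ↔
      (∀ i, |a i - α i| ≤ R) ∧ ∀ j, |b j - β j| ≤ R := by
    intro a b
    simp only [Set.mem_prod, Set.mem_pi, Set.mem_univ, true_implies, Set.mem_Icc, abs_sub_le_iff]
    constructor
    · rintro ⟨h1, h2⟩
      exact ⟨fun i => ⟨by linarith [(h1 i).2], by linarith [(h1 i).1]⟩,
        fun j => ⟨by linarith [(h2 j).2], by linarith [(h2 j).1]⟩⟩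
    · rintro ⟨h1, h2⟩
      exact ⟨fun i => ⟨by linarith [(h1 i).2], by linarith [(h1 i).1]⟩,
        fun j => ⟨by linarith [(h2 j).2], by linarith [(h2 j).1]⟩⟩
  obtain ⟨⟨a, b⟩, hab, hmax⟩ :=
    (((isCompact_univ_pi fun i => isCompact_Icc (a := α i - R) (b := α i + R)).prod
      (isCompact_univ_pi fun j => isCompact_Icc (a := β j - R) (b := β j + R)))).exists_isMaxOn
      ⟨(α, β), (mem α β).2 (by simp [hR.le])⟩ (continuous_logisticLik y).continuousOn
  obtain ⟨ha, hb⟩ := (mem a b).1 hab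
  have hmax' : ∀ (a' : ι → ℝ) (b' : κ → ℝ), (∀ i, |a' i - α i| ≤ R) → (∀ j, |b' j - β j| ≤ R) →
      logisticLik y a' b' ≤ logisticLik y a b :=
    fun a' b' h1 h2 => hmax ((mem a' b').2 ⟨h1, h2⟩)
  refine ⟨a, b, ha, hb, ?_⟩
  have H := isBoxCritical_of_box_max hR hB ha hb hmax' hrow hcol
  have hι : Nonempty ι := Fintype.card_pos_iff.1 (by exact_mod_cast hk0.trans_le hk)
  have hκ : Nonempty κ := Fintype.card_pos_iff.1 (by exact_mod_cast hk0.trans_le hk')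
  have hB0 : 0 ≤ B := by
    linarith [hB hι.some hκ.some, abs_nonneg (α hι.some + β hκ.some)]
  have hq1 : Real.exp (-B) / 4 ≤ 1 := by
    linarith [Real.exp_le_one_iff.2 (by linarith : -B ≤ 0)]
  -- It is enough that some gauge shift of the maximizer lies in the open box.
  have key : ∀ c : ℝ, (∀ i, |a i + c - α i| < R) → (∀ j, |b j - c - β j| < R) →
      ∀ (a' : ι → ℝ) (b' : κ → ℝ), logisticLik y a' b' ≤ logisticLik y a b := by
    intro c h1 h2 a' b'
    rw [← logisticLik_shift y a b c]
    exact logisticLik_le_of_open_box h1 h2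
      (fun a' b' h1 h2 => by rw [logisticLik_shift]; exact hmax' a' b' h1 h2) a' b'
  rcases H.not_touch hR (by positivity) hq1 hk0 hk hk' hD with ⟨h1, h2⟩ | ⟨h1, h2⟩
  -- Only `u = -R` and `v = R` can be attained here, and raising `a` while lowering `b` leaves both.
  · have e1 : ∀ᶠ t in 𝓝[>] (0 : ℝ), ∀ i, a i - α i + t * 1 < R :=
      eventually_all.2 fun i => eventually_add_mul_lt (h1 i)
    have e2 : ∀ᶠ t in 𝓝[>] (0 : ℝ), ∀ j, -(b j - β j) + t * 1 < R :=
      eventually_all.2 fun j => eventually_add_mul_lt (by linarith [h2 j])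
    obtain ⟨t, ht1, ht2, ht0⟩ := (e1.and (e2.and self_mem_nhdsWithin)).exists
    have ht0 : 0 < t := ht0
    refine key t (fun i => abs_lt.2 ⟨?_, ?_⟩) (fun j => abs_lt.2 ⟨?_, ?_⟩)
    · linarith [(abs_le.1 (ha i)).1]
    · linarith [ht1 i]
    · linarith [ht2 j]
    · linarith [(abs_le.1 (hb j)).2]
  · have e1 : ∀ᶠ t in 𝓝[>] (0 : ℝ), ∀ i, -(a i - α i) + t * 1 < R :=
      eventually_all.2 fun i => eventually_add_mul_lt (by linarith [h1 i])
    have e2 : ∀ᶠ t in 𝓝[>] (0 : ℝ), ∀ j, b j - β j + t * 1 < R :=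
      eventually_all.2 fun j => eventually_add_mul_lt (h2 j)
    obtain ⟨t, ht1, ht2, ht0⟩ := (e1.and (e2.and self_mem_nhdsWithin)).exists
    have ht0 : 0 < t := ht0
    refine key (-t) (fun i => abs_lt.2 ⟨?_, ?_⟩) (fun j => abs_lt.2 ⟨?_, ?_⟩)
    · linarith [ht1 i]
    · linarith [(abs_le.1 (ha i)).2]
    · linarith [(abs_le.1 (hb j)).1]
    · linarith [ht2 j]

end

end Box

namespace Affiliation

variable {m n : ℕ}

/-! ### Likelihood, uniqueness, and existence on a good event -/

theorem logLikelihood_eq_logisticLik (x : Graph m n) (θ : Param m n) :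
    logLikelihood x θ = logisticLik (entry x) (alpha θ) (beta θ) := by
  simp only [logLikelihood, logisticLik, rowDegree, colDegree, Finset.sum_sub_distrib, add_mul,
    Finset.sum_add_distrib, Finset.mul_sum]
  rw [Finset.sum_comm (f := fun (j : Fin n) (i : Fin m) => beta θ j * _)]

theorem beta_last (hn : 1 ≤ n) (θ : Param m n) : beta θ ⟨n - 1, by omega⟩ = 0 := by
  simp [beta]

theorem beta_inr (θ : Param m n) (j : Fin (n - 1)) :
    beta θ ⟨j, by omega⟩ = θ (Sum.inr j) := by
  simp [beta]

/-- The normalization `β_n = 0` removes the gauge freedom, so strict concavity in the sums `α_i +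
β_j` becomes uniqueness in `θ`. -/
theorem eq_of_alpha_add_beta_eq (hm : 1 ≤ m) (hn : 1 ≤ n) {θ θ' : Param m n}
    (h : ∀ i j, alpha θ i + beta θ j = alpha θ' i + beta θ' j) : θ = θ' := by
  have ha : ∀ i, alpha θ i = alpha θ' i := fun i => by
    simpa only [beta_last hn, add_zero] using h i ⟨n - 1, by omega⟩
  have hb : ∀ j, beta θ j = beta θ' j := fun j => by
    have := h ⟨0, hm⟩ j
    rw [ha] at this
    linarith
  funext k
  rcases k with i | j
  · exact ha i
  · rw [← beta_inr θ, ← beta_inr θ', hb]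

theorem beta_midpoint (θ θ' : Param m n) (j : Fin n) :
    beta (fun k => (θ k + θ' k) / 2) j = (beta θ j + beta θ' j) / 2 := by
  unfold beta
  split <;> simp

theorem IsMLE.unique (hm : 1 ≤ m) (hn : 1 ≤ n) {x : Graph m n} {θ θ' : Param m n}
    (h : IsMLE x θ) (h' : IsMLE x θ') : θ = θ' := by
  by_contra hne
  have hex : ∃ i j, alpha θ i + beta θ j ≠ alpha θ' i + beta θ' j := by
    by_contra! hcon
    exact hne (eq_of_alpha_add_beta_eq hm hn hcon)
  obtain ⟨i₀, j₀, h₀⟩ := hex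
  set η : Param m n := fun k => (θ k + θ' k) / 2 with hη
  have hsum : ∀ i j, alpha η i + beta η j
      = (1 / 2 : ℝ) • (alpha θ i + beta θ j) + (1 / 2 : ℝ) • (alpha θ' i + beta θ' j) := by
    intro i j
    rw [hη, beta_midpoint]
    simp only [alpha, smul_eq_mul]
    ring
  let g : ℝ → ℝ → ℝ := fun y t => t * y - Real.log (1 + Real.exp t)
  have hle : ∀ i j, (1 / 2 : ℝ) * g (entry x i j) (alpha θ i + beta θ j)
      + (1 / 2 : ℝ) * g (entry x i j) (alpha θ' i + beta θ' j)
      ≤ g (entry x i j) (alpha η i + beta η j) := by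
    intro i j
    rw [hsum]
    exact (concaveOn_logistic_term (entry x i j)).2 (Set.mem_univ _) (Set.mem_univ _)
      (by norm_num) (by norm_num) (by norm_num)
  have hlt : (1 / 2 : ℝ) * g (entry x i₀ j₀) (alpha θ i₀ + beta θ j₀)
      + (1 / 2 : ℝ) * g (entry x i₀ j₀) (alpha θ' i₀ + beta θ' j₀)
      < g (entry x i₀ j₀) (alpha η i₀ + beta η j₀) := by
    rw [hsum]
    have := strictConvexOn_log_one_add_exp.2 (Set.mem_univ (alpha θ i₀ + beta θ j₀))
      (Set.mem_univ (alpha θ' i₀ + beta θ' j₀)) h₀ (by norm_num : (0 : ℝ) < 1 / 2)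
      (by norm_num : (0 : ℝ) < 1 / 2) (by norm_num)
    simp only [smul_eq_mul] at this
    simp only [g, smul_eq_mul]
    linarith
  have hlt' : (1 / 2 : ℝ) * logLikelihood x θ + (1 / 2 : ℝ) * logLikelihood x θ'
      < logLikelihood x η := by
    simp only [logLikelihood_eq_logisticLik, logisticLik, Finset.mul_sum,
      ← Finset.sum_add_distrib]
    exact Finset.sum_lt_sum (fun i _ => Finset.sum_le_sum fun j _ => hle i j)
      ⟨i₀, Finset.mem_univ _, Finset.sum_lt_sum (fun j _ => hle i₀ j)
        ⟨j₀, Finset.mem_univ _, hlt⟩⟩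
  linarith [h η, h' η]

theorem abs_alpha_le (θ : Param m n) (i : Fin m) : |alpha θ i| ≤ ‖θ‖ := norm_le_pi_norm θ _

theorem abs_beta_le (θ : Param m n) (j : Fin n) : |beta θ j| ≤ ‖θ‖ := by
  unfold beta
  split
  · exact norm_le_pi_norm θ _
  · simp

/-- The event that all row and column residuals at `θ` are at most `D`. -/
def residualsLE (θ : Param m n) (D : ℝ) : Set (Graph m n) :=
  {x | (∀ i, |∑ j, (entry x i j - Real.sigmoid (alpha θ i + beta θ j))| ≤ D) ∧
    ∀ j, |∑ i, (entry x i j - Real.sigmoid (alpha θ i + beta θ j))| ≤ D}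

theorem exists_isMLE_near (hn : 1 ≤ n) {θ : Param m n} {R D k : ℝ} (hR : 0 < R) (hR1 : R ≤ 1)
    (hk0 : 0 < k) (hkm : k ≤ m) (hkn : k ≤ n)
    (hD : 2 * D < k * (Real.exp (-(2 * ‖θ‖ + 2)) / 4) ^ 2 * R) {x : Graph m n}
    (hx : x ∈ residualsLE θ D) : ∃ θ' : Param m n, IsMLE x θ' ∧ ‖θ' - θ‖ ≤ 2 * R := by
  obtain ⟨a, b, ha, hb, hmax⟩ := exists_logisticLik_max_near (y := entry x) (α := alpha θ)
    (β := beta θ) hR (B := 2 * ‖θ‖ + 2) (fun i j => by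
      linarith [abs_add_le (alpha θ i) (beta θ j), abs_alpha_le θ i, abs_beta_le θ j])
    hk0 (by simpa using hkm) (by simpa using hkn) hD hx.1 hx.2
  -- The shift annihilating the last column effect; `|c| ≤ R` because the true one is zero.
  let c : ℝ := b ⟨n - 1, by omega⟩
  let θ' : Param m n := Sum.elim (fun i => a i + c) (fun j => b ⟨j, by omega⟩ - c)
  have hα : alpha θ' = fun i => a i + c := rfl
  have hβ : beta θ' = fun j => b j - c := by
    funext j
    unfold beta
    split
    · rfl
    · have : j = ⟨n - 1, by omega⟩ := Fin.ext (by simp only; omega)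
      rw [this]
      simp [c]
  have hc : |c| ≤ R := by simpa [beta_last hn] using hb ⟨n - 1, by omega⟩
  rw [abs_le] at hc
  refine ⟨θ', fun η => ?_, (pi_norm_le_iff_of_nonneg (by linarith)).2 ?_⟩
  · rw [logLikelihood_eq_logisticLik, logLikelihood_eq_logisticLik, hα, hβ, logisticLik_shift]
    exact hmax _ _
  · rintro (i | j)
    · have := abs_le.1 (ha i)
      change |a i + c - alpha θ i| ≤ _
      rw [abs_le]
      constructor <;> linarith
    · have := abs_le.1 (hb ⟨j, by omega⟩)
      rw [beta_inr] at this
      change |b ⟨j, _⟩ - c - θ (Sum.inr j)| ≤ _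
      rw [abs_le]
      constructor <;> linarith

/-! ### Concentration of the residuals -/

theorem integral_entry (θ : Param m n) (i : Fin m) (j : Fin n) :
    ∫ x, entry x i j ∂law θ = Real.sigmoid (alpha θ i + beta θ j) := by
  have h := (measurePreserving_eval (fun p : Fin m × Fin n =>
    bernoulliMeasure true false (unitInterval.sigmoid (alpha θ p.1 + beta θ p.2))) (i, j))
  have h2 : ∫ x, entry x i j ∂law θ = ∫ z : Bool, (if z then (1 : ℝ) else 0)
      ∂bernoulliMeasure true false (unitInterval.sigmoid (alpha θ i + beta θ j)) := by
    rw [← h.map_eq, integral_map h.measurable.aemeasurable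
      (measurable_of_finite _).aestronglyMeasurable]
    rfl
  rw [h2, integral_bernoulliMeasure]
  simp only [if_true, smul_eq_mul, mul_one, Bool.false_eq_true, if_false, mul_zero, add_zero]
  rfl

/-- Hoeffding's lemma for independent entries in `[0, 1]`. A general index set `s` serves rows and
columns alike. -/
theorem hasSubgaussianMGF_sum_residuals (θ : Param m n) (s : Finset (Fin m × Fin n)) :
    HasSubgaussianMGF (fun x : Graph m n =>
      ∑ p ∈ s, (entry x p.1 p.2 - Real.sigmoid (alpha θ p.1 + beta θ p.2)))
      (∑ _p ∈ s, (1 / 2) ^ 2) (law θ) := by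
  have hind : iIndepFun (fun (p : Fin m × Fin n) (x : Graph m n) =>
      entry x p.1 p.2 - Real.sigmoid (alpha θ p.1 + beta θ p.2)) (law θ) :=
    iIndepFun_pi (X := fun (p : Fin m × Fin n) (z : Bool) =>
      (if z then (1 : ℝ) else 0) - Real.sigmoid (alpha θ p.1 + beta θ p.2))
      fun p => (measurable_of_finite _).aemeasurable
  refine HasSubgaussianMGF.sum_of_iIndepFun hind fun p _ => ?_
  have := hasSubgaussianMGF_of_mem_Icc (μ := law θ) (X := fun x : Graph m n => entry x p.1 p.2)
    (a := 0) (b := 1) (measurable_of_finite _).aemeasurable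
    (Eventually.of_forall fun x => by unfold entry; split <;> simp)
  rw [integral_entry] at this
  simpa using this

theorem law_real_abs_sum_residuals_gt_le (θ : Param m n) (s : Finset (Fin m × Fin n)) {D : ℝ}
    (hD : 0 ≤ D) :
    (law θ).real {x : Graph m n |
      D < |∑ p ∈ s, (entry x p.1 p.2 - Real.sigmoid (alpha θ p.1 + beta θ p.2))|}
      ≤ 2 * Real.exp (-(2 * D ^ 2 / s.card)) := by
  have h := hasSubgaussianMGF_sum_residuals θ s
  have h1 := h.measure_ge_le hD
  have h2 := h.neg.measure_ge_le hD
  have e : -D ^ 2 / (2 * ((∑ _p ∈ s, (1 / 2) ^ 2 : NNReal) : ℝ)) = -(2 * D ^ 2 / s.card) := by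
    rcases s.eq_empty_or_nonempty with rfl | hs
    · simp
    · have : (0 : ℝ) < s.card := by exact_mod_cast hs.card_pos
      push_cast
      rw [Finset.sum_const, nsmul_eq_mul]
      field_simp
  rw [e] at h1 h2
  rw [two_mul]
  refine le_trans ?_ ((measureReal_union_le _ _).trans (add_le_add h1 h2))
  refine measureReal_mono fun x hx => ?_
  rcases lt_abs.1 (show D < |_| from hx) with h | h
  · exact Or.inl h.le
  · exact Or.inr h.le

theorem law_real_compl_residualsLE_le (θ : Param m n) {D L : ℝ} (hD : 0 ≤ D)
    (hm : L * m ≤ 2 * D ^ 2) (hn : L * n ≤ 2 * D ^ 2) (hm0 : 1 ≤ m) (hn0 : 1 ≤ n) :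
    (law θ).real (residualsLE θ D)ᶜ ≤ (m + n) * (2 * Real.exp (-L)) := by
  have hm0' : (0 : ℝ) < m := by exact_mod_cast hm0
  have hn0' : (0 : ℝ) < n := by exact_mod_cast hn0
  have hrow : ∀ i : Fin m, (law θ).real {x : Graph m n |
      D < |∑ j, (entry x i j - Real.sigmoid (alpha θ i + beta θ j))|} ≤ 2 * Real.exp (-L) := by
    intro i
    have := law_real_abs_sum_residuals_gt_le θ (({i} : Finset (Fin m)) ×ˢ Finset.univ) hD
    simp only [Finset.sum_product, Finset.sum_singleton, Finset.card_product,
      Finset.card_singleton, one_mul, Finset.card_univ, Fintype.card_fin] at this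
    refine this.trans ?_
    gcongr
    rwa [le_div_iff₀ hn0']
  have hcol : ∀ j : Fin n, (law θ).real {x : Graph m n |
      D < |∑ i, (entry x i j - Real.sigmoid (alpha θ i + beta θ j))|} ≤ 2 * Real.exp (-L) := by
    intro j
    have := law_real_abs_sum_residuals_gt_le θ (Finset.univ ×ˢ ({j} : Finset (Fin n))) hD
    simp only [Finset.sum_product, Finset.sum_singleton, Finset.card_product,
      Finset.card_singleton, mul_one, Finset.card_univ, Fintype.card_fin] at this
    refine this.trans ?_
    gcongr
    rwa [le_div_iff₀ hm0']
  have hsub : (residualsLE θ D)ᶜ ⊆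
      (⋃ i : Fin m, {x : Graph m n |
        D < |∑ j, (entry x i j - Real.sigmoid (alpha θ i + beta θ j))|}) ∪
      ⋃ j : Fin n, {x : Graph m n |
        D < |∑ i, (entry x i j - Real.sigmoid (alpha θ i + beta θ j))|} := by
    intro x hx
    by_contra hcon
    simp only [Set.mem_union, Set.mem_iUnion, Set.mem_ofPred_eq, not_or, not_exists, not_lt] at hcon
    exact hx hcon
  calc (law θ).real (residualsLE θ D)ᶜ ≤ _ := measureReal_mono hsub
    _ ≤ _ := measureReal_union_le _ _
    _ ≤ ∑ _i : Fin m, 2 * Real.exp (-L) + ∑ _j : Fin n, 2 * Real.exp (-L) :=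
        add_le_add
          ((measureReal_iUnion_fintype_le _).trans (Finset.sum_le_sum fun i _ => hrow i))
          ((measureReal_iUnion_fintype_le _).trans (Finset.sum_le_sum fun j _ => hcol j))
    _ = (m + n) * (2 * Real.exp (-L)) := by simp; ring

end Affiliation

namespace Affiliation

/-! ### Asymptotics -/

/-- As `6τ < 1/4`, the exponential is at most `n^(1/4)`, and the rate is dominated by `L^(1/2) exp
(-L/4)` at `L = log n`. -/
theorem tendsto_rate_zero {τ : ℝ} (hτ : τ < 1 / 24) {N : ℕ → ℝ}
    (hN : ∀ᶠ n : ℕ in atTop, N n ≤ τ * Real.log n) :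
    Tendsto (fun n : ℕ => Real.sqrt (Real.log n) * Real.exp (6 * N n) / Real.sqrt n)
      atTop (𝓝 0) := by
  have h := (tendsto_rpow_mul_exp_neg_mul_atTop_nhds_zero (1 / 2) (1 / 4) (by norm_num)).comp
    (Real.tendsto_log_atTop.comp tendsto_natCast_atTop_atTop)
  refine squeeze_zero' (Eventually.of_forall fun n => by positivity) ?_ h
  filter_upwards [hN, eventually_ge_atTop 1] with n hn hn1
  have hn0 : (0 : ℝ) < n := by exact_mod_cast hn1
  have hlog : 0 ≤ Real.log n := Real.log_natCast_nonneg n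
  simp only [Function.comp_apply]
  rw [← Real.sqrt_eq_rpow, mul_div_assoc]
  gcongr
  have hs : Real.sqrt n = Real.exp (Real.log n / 2) := by
    rw [Real.sqrt_eq_rpow, Real.rpow_def_of_pos hn0]
    congr 1
    ring
  rw [hs, ← Real.exp_sub]
  gcongr
  nlinarith

theorem tendsto_law_real_compl_residualsLE {c C : ℝ} (hc : 0 < c) (hC : 0 ≤ C) {m : ℕ → ℕ}
    (hm : ∀ᶠ n : ℕ in atTop, c * (n : ℝ) ≤ (m n : ℝ) ∧ (m n : ℝ) ≤ C * (n : ℝ))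
    (θ : ∀ n : ℕ, Param (m n) n) :
    Tendsto (fun n : ℕ => (law (θ n)).real
      (residualsLE (θ n) ((1 + C) * (Real.sqrt n * Real.sqrt (Real.log n))))ᶜ) atTop (𝓝 0) := by
  have h : Tendsto (fun n : ℕ => (2 * (C + 1)) * ((n : ℝ))⁻¹) atTop (𝓝 0) := by
    simpa using tendsto_inv_atTop_nhds_zero_nat.const_mul (2 * (C + 1))
  refine squeeze_zero' (Eventually.of_forall fun n => measureReal_nonneg) ?_ h
  filter_upwards [hm, eventually_ge_atTop 1] with n hmn hn1
  have hn0 : (0 : ℝ) < n := by exact_mod_cast hn1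
  have hm1 : 1 ≤ m n := by
    have : (0 : ℝ) < m n := lt_of_lt_of_le (by positivity) hmn.1
    exact_mod_cast this
  have hlog : 0 ≤ Real.log n := Real.log_natCast_nonneg n
  have hln : 0 ≤ n * Real.log n := by positivity
  have hD2 : ((1 + C) * (Real.sqrt n * Real.sqrt (Real.log n))) ^ 2
      = (1 + C) ^ 2 * (n * Real.log n) := by
    rw [mul_pow, mul_pow, Real.sq_sqrt hn0.le, Real.sq_sqrt hlog]
  -- Each tail is then at most `2 / n²`, and a union over at most `(C + 1) n` sums leaves `O(1/n)`.
  -- The factor `(1 + C)²` in `D²` dominates both `1` and `C`.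
  refine (law_real_compl_residualsLE_le (θ n) (L := 2 * Real.log n) (by positivity)
    ?_ ?_ hm1 hn1).trans ?_
  · rw [hD2]
    have h1 : 2 * Real.log n * m n ≤ 2 * Real.log n * (C * n) := by gcongr; exact hmn.2
    nlinarith [mul_nonneg hC hln, mul_nonneg (mul_nonneg hC hC) hln]
  · rw [hD2]
    nlinarith [mul_nonneg hC hln, mul_nonneg (mul_nonneg hC hC) hln]
  · have he : Real.exp (-(2 * Real.log n)) = (n : ℝ)⁻¹ * (n : ℝ)⁻¹ := by
      rw [two_mul, neg_add, Real.exp_add, Real.exp_neg, Real.exp_log hn0]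
    rw [he]
    calc ((m n : ℝ) + n) * (2 * ((n : ℝ)⁻¹ * (n : ℝ)⁻¹))
        ≤ (C * n + n) * (2 * ((n : ℝ)⁻¹ * (n : ℝ)⁻¹)) := by gcongr; exact hmn.2
      _ = 2 * (C + 1) * (n : ℝ)⁻¹ := by field_simp

/-- With probability tending to one, the likelihood has a maximizer within a constant multiple of
the rate. -/
theorem exists_good_events {τ c C : ℝ} (hτ : τ < 1 / 24) (hc : 0 < c) {m : ℕ → ℕ}
    (hm : ∀ᶠ n : ℕ in atTop, c * (n : ℝ) ≤ (m n : ℝ) ∧ (m n : ℝ) ≤ C * (n : ℝ))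
    {θ : ∀ n : ℕ, Param (m n) n} (hθ : ∀ᶠ n : ℕ in atTop, ‖θ n‖ ≤ τ * Real.log (n : ℝ)) :
    ∃ (M : ℝ) (G : ∀ n : ℕ, Set (Graph (m n) n)), 0 < M ∧
      Tendsto (fun n => law (θ n) (G n)ᶜ) atTop (𝓝 0) ∧
      ∀ᶠ n : ℕ in atTop, ∀ x ∈ G n, ∃ θ' : Param (m n) n, IsMLE x θ' ∧
        ‖θ' - θ n‖ ≤ M * (Real.sqrt (Real.log (n : ℝ)) * Real.exp (6 * ‖θ n‖) / Real.sqrt n) := by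
  have hC : 0 ≤ C := by
    obtain ⟨n, hn, hn1⟩ := (hm.and (eventually_ge_atTop 1)).exists
    have hn0 : (0 : ℝ) < n := by exact_mod_cast hn1
    have : c * n ≤ C * n := hn.1.trans hn.2
    nlinarith
  set q : ℝ := Real.exp (-2) / 4 with hq
  have hq0 : 0 < q := by positivity
  -- Makes `k = c₀ * n` a lower bound for both dimensions.
  set c₀ : ℝ := min 1 c with hc₀
  have hc₀0 : 0 < c₀ := lt_min one_pos hc
  -- The `3` beats the `2` in `2 * D`, giving the strict inequality.
  set K : ℝ := 3 * (1 + C) / (c₀ * q ^ 2) with hK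
  have hK0 : 0 < K := by positivity
  have hKq : c₀ * q ^ 2 * K = 3 * (1 + C) := by
    rw [hK]
    field_simp
  refine ⟨2 * K, fun n => residualsLE (θ n) ((1 + C) * (Real.sqrt n * Real.sqrt (Real.log n))),
    by positivity, ?_, ?_⟩
  · have h := tendsto_law_real_compl_residualsLE hc hC hm θ
    rw [← ENNReal.tendsto_toReal_iff (fun n => measure_ne_top _ _) ENNReal.zero_ne_top]
    rw [ENNReal.toReal_zero]
    exact h
  · have hrate := (tendsto_rate_zero hτ hθ).const_mul K
    rw [mul_zero] at hrate
    filter_upwards [hm, hrate.eventually_le_const one_pos, eventually_ge_atTop 2]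
      with n hmn hR1 hn2 x hx
    have hn0 : (0 : ℝ) < n := by positivity
    have hlog : 0 < Real.log n := Real.log_pos (by exact_mod_cast hn2)
    have hsn : 0 < Real.sqrt n := Real.sqrt_pos.2 hn0
    have hsl : 0 < Real.sqrt (Real.log n) := Real.sqrt_pos.2 hlog
    have hD : 2 * ((1 + C) * (Real.sqrt n * Real.sqrt (Real.log n)))
        < c₀ * n * (Real.exp (-(2 * ‖θ n‖ + 2)) / 4) ^ 2 *
          (K * (Real.sqrt (Real.log (n : ℝ)) * Real.exp (6 * ‖θ n‖) / Real.sqrt n)) := by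
      -- The squared slope costs only `exp (-4‖θ‖)`; the surplus `exp (2‖θ‖) ≥ 1` is discarded
      -- below.
      have e1 : (Real.exp (-(2 * ‖θ n‖ + 2)) / 4) ^ 2 * Real.exp (6 * ‖θ n‖)
          = q ^ 2 * Real.exp (2 * ‖θ n‖) := by
        have : Real.exp (-(2 * ‖θ n‖ + 2)) ^ 2 * Real.exp (6 * ‖θ n‖)
            = Real.exp (-2) ^ 2 * Real.exp (2 * ‖θ n‖) := by
          simp only [← Real.exp_nat_mul, ← Real.exp_add]
          congr 1
          push_cast
          ring
        rw [hq, div_pow, div_pow]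
        linear_combination this / 4 ^ 2
      have e2 : (n : ℝ) / Real.sqrt n = Real.sqrt n := Real.div_sqrt
      have e3 : c₀ * n * (Real.exp (-(2 * ‖θ n‖ + 2)) / 4) ^ 2 *
          (K * (Real.sqrt (Real.log (n : ℝ)) * Real.exp (6 * ‖θ n‖) / Real.sqrt n))
          = 3 * (1 + C) * Real.exp (2 * ‖θ n‖) * (Real.sqrt n * Real.sqrt (Real.log n)) := by
        calc _ = c₀ * K * ((Real.exp (-(2 * ‖θ n‖ + 2)) / 4) ^ 2 * Real.exp (6 * ‖θ n‖))
              * ((n / Real.sqrt n) * Real.sqrt (Real.log n)) := by ring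
          _ = (c₀ * q ^ 2 * K) * Real.exp (2 * ‖θ n‖)
              * (Real.sqrt n * Real.sqrt (Real.log n)) := by rw [e1, e2]; ring
          _ = _ := by rw [hKq]
      rw [e3]
      have h1 : 1 ≤ Real.exp (2 * ‖θ n‖) := Real.one_le_exp (by positivity)
      have h2 : 0 < (1 + C) * (Real.sqrt n * Real.sqrt (Real.log n)) := by positivity
      nlinarith
    obtain ⟨θ', h1, h2⟩ := exists_isMLE_near (by omega) (θ := θ n)
      (R := K * (Real.sqrt (Real.log (n : ℝ)) * Real.exp (6 * ‖θ n‖) / Real.sqrt n))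
      (k := c₀ * n) (by positivity) hR1 (by positivity)
      (le_trans (by gcongr; exact min_le_right _ _) hmn.1)
      (by
        have : c₀ * n ≤ 1 * n := by gcongr; exact min_le_left _ _
        linarith) hD hx
    exact ⟨θ', h1, by linarith⟩

end Affiliation

/-! ### Stochastic orders and the final assembly -/

theorem isBigOInProbability_of_good_events {Ω : ℕ → Type*} [∀ n, MeasurableSpace (Ω n)]
    {P : ∀ n, Measure (Ω n)} {Y : ∀ n, Ω n → ℝ} {a : ℕ → ℝ} {M : ℝ} (hM : 0 < M)
    {G : ∀ n, Set (Ω n)} (hG : Tendsto (fun n => P n (G n)ᶜ) atTop (𝓝 0))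
    (h : ∀ᶠ n in atTop, ∀ ω ∈ G n, |Y n ω| ≤ M * a n) : IsBigOInProbability P Y a := by
  refine fun ε hε => ⟨M, hM, ?_⟩
  filter_upwards [h, hG.eventually_le_const (ENNReal.ofReal_pos.2 hε)] with n hn hε
  refine (measure_mono fun ω hω hωG => ?_).trans hε
  exact not_lt.2 (hn ω hωG) hω

theorem IsBigOInProbability.isLittleO {Ω : ℕ → Type*} [∀ n, MeasurableSpace (Ω n)]
    {P : ∀ n, Measure (Ω n)} {Y : ∀ n, Ω n → ℝ} {a : ℕ → ℝ} (h : IsBigOInProbability P Y a)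
    (ha : Tendsto a atTop (𝓝 0)) : IsLittleOInProbability P Y (fun _ => 1) := by
  intro δ hδ
  rw [ENNReal.tendsto_nhds_zero]
  intro ε hε
  obtain ⟨r, -, hr0, hrε⟩ := ENNReal.lt_iff_exists_real_btwn.1 hε
  have hr : 0 < r := by simpa using hr0
  obtain ⟨M, hM, hev⟩ := h r hr
  have hMa := ha.const_mul M
  rw [mul_zero] at hMa
  filter_upwards [hev, hMa.eventually_le_const hδ] with n hn hδn
  refine ((measure_mono fun ω hω => ?_).trans hn).trans hrε.le
  have hω : δ * 1 < |Y n ω| := hω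
  change M * a n < |Y n ω|
  linarith

theorem theorem1 :
    -- consistency along an arbitrary sequence of models with `m n` rows and `n` columns
    (∀ (τ c C : ℝ), 0 < τ → τ < 1 / 24 → 0 < c → ∀ (m : ℕ → ℕ),
      (∀ᶠ n : ℕ in atTop, c * (n : ℝ) ≤ (m n : ℝ) ∧ (m n : ℝ) ≤ C * (n : ℝ)) →
      ∀ (θ : ∀ n : ℕ, Affiliation.Param (m n) n),
      (∀ᶠ n : ℕ in atTop, ‖θ n‖ ≤ τ * Real.log (n : ℝ)) →
      -- the MLE exists with probability tending to one
      Tendsto (fun n : ℕ => Affiliation.law (θ n)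
        {x | ∃ θ' : Affiliation.Param (m n) n, Affiliation.IsMLE x θ'}) atTop (𝓝 1) ∧
      -- `θhat n x` is the MLE whenever the MLE exists
      (∀ (θhat : ∀ n : ℕ, Affiliation.Graph (m n) n → Affiliation.Param (m n) n),
        (∀ (n : ℕ) (x : Affiliation.Graph (m n) n),
          (∃ θ' : Affiliation.Param (m n) n, Affiliation.IsMLE x θ') →
            Affiliation.IsMLE x (θhat n x)) →
        IsBigOInProbability (fun n => Affiliation.law (θ n)) (fun n x => ‖θhat n x - θ n‖)
          (fun n => Real.sqrt (Real.log (n : ℝ)) * Real.exp (6 * ‖θ n‖) / Real.sqrt (n : ℝ)) ∧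
        IsLittleOInProbability (fun n => Affiliation.law (θ n)) (fun n x => ‖θhat n x - θ n‖)
          (fun _ => 1)) ∧
      -- the rate itself tends to zero
      Tendsto (fun n : ℕ =>
        Real.sqrt (Real.log (n : ℝ)) * Real.exp (6 * ‖θ n‖) / Real.sqrt (n : ℝ)) atTop (𝓝 0)) ∧
    -- uniqueness of the MLE, for every size and every observation
    (∀ (m n : ℕ), 1 ≤ m → 1 ≤ n → ∀ (x : Affiliation.Graph m n)
      (θ₁ θ₂ : Affiliation.Param m n),
      Affiliation.IsMLE x θ₁ → Affiliation.IsMLE x θ₂ → θ₁ = θ₂) := by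
  refine ⟨?_, fun m n hm hn x θ₁ θ₂ h₁ h₂ => h₁.unique hm hn h₂⟩
  intro τ c C _ hτ hc m hm θ hθ
  have hrate := Affiliation.tendsto_rate_zero hτ hθ
  obtain ⟨M, G, hM, hG, hgood⟩ := Affiliation.exists_good_events hτ hc hm hθ
  refine ⟨?_, fun θhat hhat => ?_, hrate⟩
  · have h1 : Tendsto (fun n => 1 - Affiliation.law (θ n) (G n)ᶜ) atTop (𝓝 1) := by
      simpa using ENNReal.Tendsto.sub tendsto_const_nhds hG (Or.inl ENNReal.one_ne_top)
    refine tendsto_of_tendsto_of_tendsto_of_le_of_le' h1 tendsto_const_nhds ?_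
      (Eventually.of_forall fun n => prob_le_one)
    filter_upwards [hgood] with n hn
    rw [tsub_le_iff_right, ← measure_univ (μ := Affiliation.law (θ n)),
      ← Set.union_compl_self (G n)]
    refine (measure_union_le _ _).trans (add_le_add_left (measure_mono fun x hx => ?_) _)
    obtain ⟨θ', hθ', -⟩ := hn x hx
    exact ⟨θ', hθ'⟩
  · have hO : IsBigOInProbability (fun n => Affiliation.law (θ n)) (fun n x => ‖θhat n x - θ n‖)
        (fun n => Real.sqrt (Real.log (n : ℝ)) * Real.exp (6 * ‖θ n‖) / Real.sqrt (n : ℝ)) := by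
      refine isBigOInProbability_of_good_events hM hG ?_
      filter_upwards [hgood, hm, eventually_ge_atTop 1] with n hn hmn hn1 x hx
      have hm1 : 1 ≤ m n := by
        have hn0 : (0 : ℝ) < n := by exact_mod_cast hn1
        have : (0 : ℝ) < m n := lt_of_lt_of_le (by positivity) hmn.1
        exact_mod_cast this
      obtain ⟨θ', hθ', hdist⟩ := hn x hx
      -- Uniqueness transfers the bound from the constructed maximizer to the arbitrary selection
      -- `θhat`.
      rw [(hhat n x ⟨θ', hθ'⟩).unique hm1 hn1 hθ', abs_norm]
      exact hdist
    exact ⟨hO, hO.isLittleO hrate⟩
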